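/- Let $\Omega\subset\mathbb{R}^n$ be a domain (open and connected), let $w\ge 0$ be integrable on $\Omega$, put $d\mu(x)=w(x)\,dx$ on $\Omega$ and $M=\mu(\Omega)<\infty$ (so $M=1$, $M/2=1/2$ for a probability measure). For a Borel set $A\subset\Omega$ let $\mu^{+}(A)=\liminf_{h\to0^+}\frac{\mu(A_h)-\mu(A)}{h}$, where $A_h=\{x\in\Omega: d(x,A)<h\}$ and $d$ is the Euclidean distance, and let $I(t)=\inf\{\mu^{+}(A): A\subset\Omega \text{ Borel},\ \mu(A)=t\}$, $0\le t\le M$, be the isoperimetric profile. Assume that $I$ is finite, continuous and concave on $[0,M]$, symmetric about $M/2$, and $I(0)=0$. For measurable $u$ write $u^{*}(s)=\inf\{t\ge0:\mu\{|u|>t\}\le s\}$ and $u^{**}(t)=\frac1t\int_0^t u^{*}(s)\,ds$. Let $X,Y$ be rearrangement invariant Banach function spaces with the Fatou property on $(\Omega,\mu)$, and let $\bar X,\bar Y$ be their representation spaces, i.e. the r.i. spaces on $(0,M)$ with Lebesgue measure such that $\|u\|_{X}=\|u^{*}\|_{\bar X}$ and $\|u\|_{Y}=\|u^{*}\|_{\bar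 Y}$ for all measurable $u$. **Theorem.** Let $k\ge1$ be an integer and suppose that the operator $$Tg(t)=\chi_{(0,M/2)}(t)\int_t^{M/2}\frac{g(u)}{I(u)}\left(\int_t^u\frac{dz}{I(z)}\right)^{k-1}du$$ is bounded from $\bar X$ to $\bar Y$. Then there is a finite constant $c$ such that for every function $f\in C^k(\Omega)$ for which $|f|,|df|,\dots,|d^{k-1}f|$ are Lipschitz on $\Omega$ (with respect to $d$), $$\|f\|_{Y}\le c\left(\bigl\|\,|d^kf|^{**}\bigr\|_{\bar X}+\sum_{j=1}^{k}\bigl\|\,|d^{k-j}f|\,\bigr\|_{L^1(\mu)}\right).$$ Here $|d^jf|(x)$ is the norm of the $j$-linear form $d^jf(x)$ ($|d^0f|=|f|$, $|d^1f|=|\nabla f|$), and both sides may be $+\infty$. -/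

import Mathlib

open MeasureTheory Set Filter Topology
open scoped ENNReal NNReal

noncomputable section

/-- Decreasing rearrangement `f*(s) = inf {t ≥ 0 : μ {f > t} ≤ s}` of a nonnegative function
(a real function `u` is rearranged through `|u|`). -/
def rearr {α : Type*} [MeasurableSpace α] (μ : Measure α) (f : α → ℝ≥0∞) (s : ℝ) : ℝ≥0∞ :=
  sInf {t : ℝ≥0∞ | μ {x | t < f x} ≤ ENNReal.ofReal s}

/-- Maximal average `f**(t) = (1/t) ∫₀ᵗ f*(s) ds`, for `t > 0`. -/
def maxAvg {α : Type*} [MeasurableSpace α] (μ : Measure α) (f : α → ℝ≥0∞) (t : ℝ) : ℝ≥0∞ :=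
  (∫⁻ s in Ioo 0 t, rearr μ f s) / ENNReal.ofReal t

/-- A rearrangement invariant Banach function space with the Fatou property over `μ`, given by its
function norm `ρ` on nonnegative functions: the norm of a (class of) measurable `u` is `ρ |u|`, and
the space is `{u | ρ |u| < ∞}`. Only values of `ρ` at a.e. measurable functions are meaningful. -/
structure RISpace {α : Type*} [MeasurableSpace α] (μ : Measure α) where
  norm : (α → ℝ≥0∞) → ℝ≥0∞
  norm_eq_zero_iff : ∀ f, AEMeasurable f μ → (norm f = 0 ↔ f =ᵐ[μ] 0)
  norm_smul : ∀ (a : ℝ≥0) f, AEMeasurable f μ → norm (fun x => a * f x) = a * norm f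
  norm_add_le : ∀ f g, AEMeasurable f μ → AEMeasurable g μ → norm (f + g) ≤ norm f + norm g
  norm_mono : ∀ f g, AEMeasurable f μ → AEMeasurable g μ → f ≤ᵐ[μ] g → norm f ≤ norm g
  fatou : ∀ f : ℕ → α → ℝ≥0∞, (∀ n, AEMeasurable (f n) μ) → Monotone f →
    norm (fun x => ⨆ n, f n x) = ⨆ n, norm (f n)
  norm_indicator_lt_top : ∀ E : Set α, MeasurableSet E → μ E < ∞ →
    norm (E.indicator fun _ => 1) < ∞
  lintegral_le : ∀ E : Set α, MeasurableSet E → μ E < ∞ →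
    ∃ C : ℝ≥0, ∀ f, AEMeasurable f μ → ∫⁻ x in E, f x ∂μ ≤ C * norm f
  norm_eq_of_rearr_eq : ∀ f g, AEMeasurable f μ → AEMeasurable g μ →
    rearr μ f = rearr μ g → norm f = norm g

/-- `X̄`, an r.i. space over the interval `(0, μ(Ω))` with Lebesgue measure, is the representation
space of the r.i. space `X` over `μ`: `‖f‖_X = ‖f*‖_X̄` for all measurable `f`. -/
def IsRepresentationSpace {α : Type*} [MeasurableSpace α] {μ : Measure α} (X : RISpace μ)
    (Xbar : RISpace (volume.restrict (Ioo (0 : ℝ) (μ.real univ)))) : Prop :=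
  ∀ f : α → ℝ≥0∞, AEMeasurable f μ → X.norm f = Xbar.norm (rearr μ f)

/-- The measure `dμ = w dx` on `Ω ⊆ ℝⁿ`, as a measure on `ℝⁿ` that vanishes off `Ω`. -/
def weightedMeasure {n : ℕ} (Ω : Set (EuclideanSpace ℝ (Fin n)))
    (w : EuclideanSpace ℝ (Fin n) → ℝ) : Measure (EuclideanSpace ℝ (Fin n)) :=
  (volume.restrict Ω).withDensity fun x => ENNReal.ofReal (w x)

/-- Minkowski content `μ⁺(A) = liminf_{h → 0+} (μ(A_h) - μ(A)) / h`. When `μ` vanishes off `Ω` and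
`A ⊆ Ω`, it makes no difference whether the neighbourhood `A_h` is taken in `Ω` or in the whole
space. -/
def minkowskiContent {E : Type*} [PseudoEMetricSpace E] [MeasurableSpace E] (μ : Measure E)
    (A : Set E) : ℝ≥0∞ :=
  liminf (fun h : ℝ => (μ (Metric.thickening h A) - μ A) / ENNReal.ofReal h) (𝓝[>] 0)

/-- Isoperimetric profile `I(t) = inf {μ⁺(A) : A ⊆ Ω Borel, μ(A) = t}` of `(Ω, d, μ)`, where `d` is
the distance of the ambient space and `μ` is a measure that vanishes off `Ω`. -/
def isoProfile {E : Type*} [PseudoEMetricSpace E] [MeasurableSpace E] (Ω : Set E) (μ : Measure E)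
    (t : ℝ) : ℝ≥0∞ :=
  sInf {p | ∃ A ⊆ Ω, MeasurableSet A ∧ μ A = ENNReal.ofReal t ∧ p = minkowskiContent μ A}

/-- Finite, continuous, concave on `[0, M]`, symmetric about `M / 2`, and zero at zero. -/
structure IsStandardProfile (I : ℝ → ℝ≥0∞) (M : ℝ) : Prop where
  ne_top : ∀ t ∈ Icc 0 M, I t ≠ ∞
  continuousOn : ContinuousOn (fun t => (I t).toReal) (Icc 0 M)
  concaveOn : ConcaveOn ℝ (Icc 0 M) fun t => (I t).toReal
  symm : ∀ t ∈ Icc 0 M, I (M - t) = I t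
  zero : I 0 = 0

/-- `T f(t) = ∫_t^a (f(u) / I(u)) (∫_t^u dz / I(z))^{k-1} du` for `0 < t < a`, and `0` for other
`t`, where `f ≥ 0`. -/
def iteratedHardy (I : ℝ → ℝ≥0∞) (a : ℝ) (k : ℕ) (f : ℝ → ℝ≥0∞) : ℝ → ℝ≥0∞ :=
  (Ioo 0 a).indicator fun t =>
    ∫⁻ u in Ioo t a, f u / I u * (∫⁻ z in Ioo t u, (I z)⁻¹) ^ (k - 1)

/-- The operator `T` (positive, linear) is bounded from `X` to `Y`. -/
def IsBoundedBetween {α β : Type*} [MeasurableSpace α] [MeasurableSpace β] {μ : Measure α}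
    {ν : Measure β} (T : (α → ℝ≥0∞) → β → ℝ≥0∞) (X : RISpace μ) (Y : RISpace ν) : Prop :=
  ∃ C : ℝ≥0, ∀ f, AEMeasurable f μ → X.norm f < ∞ → Y.norm (T f) ≤ C * X.norm f

/-- The size `|d^j f|(x)` of the `j`-th derivative: the norm of the `j`-linear form
`d^j f(x)`. In particular `|d^0 f| = |f|` and `|d^1 f| = |∇ f|`. -/
def derivSize {n : ℕ} (j : ℕ) (f : EuclideanSpace ℝ (Fin n) → ℝ)
    (x : EuclideanSpace ℝ (Fin n)) : ℝ≥0∞ :=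
  ‖iteratedFDeriv ℝ j f x‖ₑ

/-- `f` is `C^k` on the open set `Ω`, and `|f|, |d f|, …, |d^{k-1} f|` are Lipschitz on `Ω`. -/
def IsSmoothLip {n : ℕ} (k : ℕ) (Ω : Set (EuclideanSpace ℝ (Fin n)))
    (f : EuclideanSpace ℝ (Fin n) → ℝ) : Prop :=
  ContDiffOn ℝ k f Ω ∧
    ∀ j < k, ∃ L : ℝ≥0, LipschitzOnWith L (fun x => ‖iteratedFDeriv ℝ j f x‖) Ω

end

/-! ### Rearrangements, maximal averages and the distribution function. -/

section Rearrangement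

variable {α : Type*} [MeasurableSpace α] {μ : Measure α}

/-! Superlevel sets reduce the problem to one dimension. If `u` is Lipschitz with local slope at
most `g`, the coarea inequality `setLIntegral_isoProfile_le` and Hardy–Littlewood bound the integral
of `I(μ{u > s})` over the levels with `μ{u > s} < r` by `∫₀ʳ g*`. Concavity and `I(0) = 0` make
`I(t)/t` nonincreasing, so `μ{u > s} I(r) ≤ r I(μ{u > s})` at these levels. As `-(u**)'(r)` is `r⁻²`
times the integral of `μ{u > s}` over them, it is at most `g**(r)/I(r)`;
`maxAvg_le_add_lintegral_div` is the integrated form.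

Take `u = |d^j f|` and `g = |d^{j+1} f|`, and iterate against `dν = dz/I(z)` on `(t, a)`, `a = M/2`.
By `rearr_derivSize_zero_le`, `f*(t)` is then at most `T(|d^k f|**)(t)` plus multiples of `‖d^i f‖₁
/ a` by powers of `ν(t, a)` with exponents below `k`. Boundedness of `T` handles the first term, and
also the others: `v^i ≤ 1 + v^k` for `i ≤ k`, and `ν(t, a)^k ≤ 2^(k-1) T1(t)` by
`measure_univ_pow_le`, so `ν(t, a)^k` has finite norm in the target space. That finiteness also
excludes zeros of `I` in `(0, a)`. -/

theorem antitone_measure_superlevel (f : α → ℝ≥0∞) :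
    Antitone fun t : ℝ≥0∞ => μ {x | t < f x} :=
  fun _ _ h => measure_mono fun _ hx => lt_of_le_of_lt h hx

/-- Right-continuity of the distribution function. -/
theorem measure_superlevel_le_of_forall_gt {f : α → ℝ≥0∞} {t b : ℝ≥0∞}
    (h : ∀ t', t < t' → μ {x | t' < f x} ≤ b) : μ {x | t < f x} ≤ b := by
  rcases eq_or_ne t ∞ with rfl | ht
  · simp
  obtain ⟨v, hv, hvt, hlim⟩ := exists_seq_strictAnti_tendsto' (lt_top_iff_ne_top.2 ht)
  have hU : {x | t < f x} = ⋃ n, {x | v n < f x} := by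
    ext x
    simp only [mem_ofPred_eq, mem_iUnion]
    constructor
    · intro hx
      exact ((hlim.eventually (gt_mem_nhds hx)).exists)
    · rintro ⟨n, hn⟩
      exact (hvt n).1.trans hn
  have hmono : Monotone fun n => {x | v n < f x} :=
    fun i j hij x hx => lt_of_le_of_lt (hv.antitone hij) hx
  rw [hU, hmono.measure_iUnion]
  exact iSup_le fun n => h _ (hvt n).1

theorem rearr_le_iff {f : α → ℝ≥0∞} {r : ℝ} {t : ℝ≥0∞} :
    rearr μ f r ≤ t ↔ μ {x | t < f x} ≤ ENNReal.ofReal r := by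
  constructor
  · intro h
    refine measure_superlevel_le_of_forall_gt fun t' ht' => ?_
    obtain ⟨t'', ht'', hlt⟩ := sInf_lt_iff.1 (lt_of_le_of_lt h ht')
    exact (antitone_measure_superlevel f hlt.le).trans ht''
  · intro h
    exact sInf_le h

theorem lt_rearr_iff {f : α → ℝ≥0∞} {r : ℝ} {t : ℝ≥0∞} :
    t < rearr μ f r ↔ ENNReal.ofReal r < μ {x | t < f x} := by
  rw [← not_le, rearr_le_iff, not_le]

theorem rearr_antitone (f : α → ℝ≥0∞) : Antitone (rearr μ f) :=
  fun _ _ h => sInf_le_sInf fun _ ht => ht.trans (ENNReal.ofReal_le_ofReal h)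

theorem lintegral_indicator_lt (c : ℝ≥0∞) :
    ∫⁻ s in Ioi (0 : ℝ), {s : ℝ | ENNReal.ofReal s < c}.indicator (fun _ => (1 : ℝ≥0∞)) s = c := by
  have hm : MeasurableSet {s : ℝ | ENNReal.ofReal s < c} :=
    measurableSet_lt ENNReal.measurable_ofReal measurable_const
  rw [lintegral_indicator_const hm, one_mul, Measure.restrict_apply hm]
  rcases eq_or_ne c ∞ with rfl | hc
  · simp
  · have : {s : ℝ | ENNReal.ofReal s < c} ∩ Ioi 0 = Ioo 0 c.toReal := by
      ext s
      simp only [mem_inter_iff, mem_ofPred_eq, mem_Ioi, mem_Ioo]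
      rw [and_comm]
      refine and_congr_right fun hs => ?_
      rw [ENNReal.ofReal_lt_iff_lt_toReal hs.le hc]
    rw [this, Real.volume_Ioo, sub_zero, ENNReal.ofReal_toReal hc]

/-- `∫₀ᵗ f*` through the distribution function. -/
theorem setLIntegral_rearr (f : α → ℝ≥0∞) (t : ℝ) :
    ∫⁻ r in Ioo 0 t, rearr μ f r =
      ∫⁻ s in Ioi (0 : ℝ), min (μ {x | ENNReal.ofReal s < f x}) (ENNReal.ofReal t) := by
  set m : ℝ → ℝ≥0∞ := fun s => μ {x | ENNReal.ofReal s < f x} with hm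
  have hanti : Antitone m := fun s s' h =>
    antitone_measure_superlevel f (ENNReal.ofReal_le_ofReal h)
  have hS : MeasurableSet {p : ℝ × ℝ | ENNReal.ofReal p.1 < m p.2} :=
    measurableSet_lt (ENNReal.measurable_ofReal.comp measurable_fst)
      (hanti.measurable.comp measurable_snd)
  have h1 : ∀ r, rearr μ f r = ∫⁻ s in Ioi (0 : ℝ),
      {p : ℝ × ℝ | ENNReal.ofReal p.1 < m p.2}.indicator (fun _ => (1 : ℝ≥0∞)) (r, s) := by
    intro r
    rw [← lintegral_indicator_lt (rearr μ f r)]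
    refine lintegral_congr fun s => ?_
    simp only [indicator, mem_ofPred_eq, lt_rearr_iff, hm]
  simp_rw [h1]
  rw [lintegral_lintegral_swap]
  · refine lintegral_congr fun s => ?_
    have hms : MeasurableSet {r : ℝ | ENNReal.ofReal r < m s} :=
      measurableSet_lt ENNReal.measurable_ofReal measurable_const
    have : ∀ r, {p : ℝ × ℝ | ENNReal.ofReal p.1 < m p.2}.indicator (fun _ => (1 : ℝ≥0∞)) (r, s)
        = {r : ℝ | ENNReal.ofReal r < m s}.indicator (fun _ => (1 : ℝ≥0∞)) r := fun r => rfl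
    simp_rw [this]
    rw [← lintegral_indicator_lt (min (m s) (ENNReal.ofReal t)),
      ← lintegral_indicator measurableSet_Ioo, ← lintegral_indicator measurableSet_Ioi]
    refine lintegral_congr fun r => ?_
    simp only [indicator, mem_Ioo, mem_Ioi, mem_ofPred_eq, lt_min_iff]
    by_cases hr : 0 < r
    · simp only [hr, true_and, if_true]
      have : ENNReal.ofReal r < ENNReal.ofReal t ↔ r < t :=
        ⟨fun h => (ENNReal.ofReal_lt_ofReal_iff'.1 h).1,
          fun h => ENNReal.ofReal_lt_ofReal_iff'.2 ⟨h, hr.trans h⟩⟩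
      by_cases h1 : r < t <;> by_cases h2 : ENNReal.ofReal r < m s <;> simp [this, h1, h2]
    · simp [hr]
  · exact (measurable_const.indicator hS).aemeasurable

/-- Hardy–Littlewood: the integral over a set of measure at most `t` is at most `∫₀ᵗ f*`. -/
theorem setLIntegral_le_setLIntegral_rearr {g : α → ℝ} (hg0 : ∀ x, 0 ≤ g x)
    (hg : AEMeasurable g μ) {E : Set α} {t : ℝ} (hE : μ E ≤ ENNReal.ofReal t) :
    ∫⁻ x in E, ENNReal.ofReal (g x) ∂μ ≤
      ∫⁻ s in Ioo 0 t, rearr μ (fun x => ENNReal.ofReal (g x)) s := by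
  rw [setLIntegral_rearr,
    lintegral_eq_lintegral_meas_lt _ (Eventually.of_forall hg0) hg.restrict]
  refine setLIntegral_mono' measurableSet_Ioi fun s hs => le_min ?_ ?_
  · refine (Measure.restrict_apply_le _ _).trans (measure_mono fun x hx => ?_)
    exact (ENNReal.ofReal_lt_ofReal_iff_of_nonneg (le_of_lt hs)).2 hx
  · exact ((measure_mono (subset_univ _)).trans (by simp)).trans hE

theorem maxAvg_le_lintegral {u : α → ℝ} (hu0 : ∀ x, 0 ≤ u x) (hu : AEMeasurable u μ) (t : ℝ) :
    maxAvg μ (fun x => ENNReal.ofReal (u x)) t ≤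
      (∫⁻ x, ENNReal.ofReal (u x) ∂μ) / ENNReal.ofReal t := by
  refine ENNReal.div_le_div_right ?_ _
  rw [setLIntegral_rearr, lintegral_eq_lintegral_meas_lt _ (Eventually.of_forall hu0) hu]
  refine setLIntegral_mono' measurableSet_Ioi fun s hs => (min_le_left _ _).trans ?_
  exact measure_mono fun x hx => (ENNReal.ofReal_lt_ofReal_iff_of_nonneg (le_of_lt hs)).1 hx

theorem rearr_le_maxAvg (f : α → ℝ≥0∞) {t : ℝ} (ht : 0 < t) : rearr μ f t ≤ maxAvg μ f t := by
  rw [maxAvg, ENNReal.le_div_iff_mul_le (Or.inl (by simpa using ht)) (Or.inl (by simp))]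
  calc rearr μ f t * ENNReal.ofReal t = ∫⁻ _ in Ioo 0 t, rearr μ f t := by simp
    _ ≤ _ := setLIntegral_mono' measurableSet_Ioo fun s hs => rearr_antitone f hs.2.le

theorem measurable_maxAvg (f : α → ℝ≥0∞) : Measurable (maxAvg μ f) := by
  refine Measurable.div ?_ ENNReal.measurable_ofReal
  exact Monotone.measurable fun s t h => lintegral_mono_set (Ioo_subset_Ioo_right h)

theorem lintegral_inv_sq {p q : ℝ} (hp : 0 < p) (hpq : p ≤ q) :
    ∫⁻ r in Ioo p q, (ENNReal.ofReal (r ^ 2))⁻¹ = ENNReal.ofReal (p⁻¹ - q⁻¹) := by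
  have hcont : ContinuousOn (fun r : ℝ => (r ^ 2)⁻¹) (Icc p q) := by
    refine ContinuousOn.inv₀ (by fun_prop) fun r hr => ?_
    have := hp.trans_le hr.1
    positivity
  have h1 : ∫⁻ r in Ioo p q, (ENNReal.ofReal (r ^ 2))⁻¹ =
      ∫⁻ r in Ioc p q, ENNReal.ofReal ((r ^ 2)⁻¹) := by
    rw [← restrict_Ioo_eq_restrict_Ioc]
    refine setLIntegral_congr_fun measurableSet_Ioo fun r hr => ?_
    have := hp.trans hr.1
    exact (ENNReal.ofReal_inv_of_pos (by positivity)).symm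
  rw [h1, ← ofReal_integral_eq_lintegral_ofReal
    ((hcont.integrableOn_Icc).mono_set Ioc_subset_Icc_self)
    (Eventually.of_forall fun r => by positivity), ← intervalIntegral.integral_of_le hpq]
  congr 1
  have := intervalIntegral.integral_eq_sub_of_hasDerivAt (f := fun r : ℝ => -r⁻¹)
    (f' := fun r => (r ^ 2)⁻¹) (a := p) (b := q) (fun r hr => ?_) ?_
  · rw [this]; ring
  · rw [uIcc_of_le hpq] at hr
    have hr0 : r ≠ 0 := (hp.trans_le hr.1).ne'
    exact (hasDerivAt_inv hr0).fun_neg.congr_deriv (neg_neg _)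
  · rw [← uIcc_of_le hpq] at hcont
    exact hcont.intervalIntegrable

/-- The function `r ↦ min(m, r)/r` equals `1` up to `m` and has derivative `-m/r²` beyond.
Integrating over `m = μ{f > s}` yields `maxAvg_le_add`. -/
theorem min_div_le {t a : ℝ} (ht : 0 < t) (hta : t ≤ a) (m : ℝ≥0∞) :
    min m (ENNReal.ofReal t) / ENNReal.ofReal t ≤ min m (ENNReal.ofReal a) / ENNReal.ofReal a +
      ∫⁻ r in Ioo t a, {r : ℝ | m < ENNReal.ofReal r}.indicator
        (fun r => m * (ENNReal.ofReal (r ^ 2))⁻¹) r := by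
  have ha := ht.trans_le hta
  rcases le_or_gt (ENNReal.ofReal a) m with h | h
  · rw [min_eq_right h, min_eq_right ((ENNReal.ofReal_le_ofReal hta).trans h),
      ENNReal.div_self (by simpa using ht) (by simp), ENNReal.div_self (by simpa using ha) (by simp)]
    exact le_self_add
  · lift m to ℝ≥0 using (h.trans ENNReal.ofReal_lt_top).ne
    have hma : (m : ℝ) < a := by
      rw [← ENNReal.ofReal_coe_nnreal] at h
      exact (ENNReal.ofReal_lt_ofReal_iff ha).1 h
    -- The integrand lives on `r > m` and `r > t`, that is, on `(p, a)`.
    set p : ℝ := max m t with hp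
    have hp0 : 0 < p := lt_max_of_lt_right ht
    have hpa : p ≤ a := max_le hma.le hta
    have h2 : (m : ℝ≥0∞) * ENNReal.ofReal (p⁻¹ - a⁻¹) ≤
        ∫⁻ r in Ioo t a, {r : ℝ | (m : ℝ≥0∞) < ENNReal.ofReal r}.indicator
        (fun r => m * (ENNReal.ofReal (r ^ 2))⁻¹) r := by
      rw [← lintegral_inv_sq hp0 hpa, ← lintegral_const_mul' _ _ ENNReal.coe_ne_top]
      refine le_trans (setLIntegral_mono' measurableSet_Ioo fun r hr => ?_)
        (lintegral_mono_set (Ioo_subset_Ioo_left (le_max_right _ _)))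
      rw [indicator_of_mem]
      rw [mem_ofPred_eq, ← ENNReal.ofReal_coe_nnreal]
      exact (ENNReal.ofReal_lt_ofReal_iff (hp0.trans hr.1)).2 ((le_max_left _ _).trans_lt hr.1)
    refine le_trans ?_ (add_le_add_right h2 _)
    rw [min_eq_left h.le, ← ENNReal.ofReal_coe_nnreal, ← ENNReal.ofReal_min,
      ← ENNReal.ofReal_div_of_pos ht, ← ENNReal.ofReal_div_of_pos ha,
      ← ENNReal.ofReal_mul m.coe_nonneg,
      ← ENNReal.ofReal_add (by positivity)
        (mul_nonneg m.coe_nonneg (sub_nonneg.2 (inv_anti₀ hp0 hpa)))]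
    refine ENNReal.ofReal_le_ofReal (le_of_eq ?_)
    have : (m : ℝ) / a + m * (p⁻¹ - a⁻¹) = m / p := by ring
    rw [this]
    rcases le_total (m : ℝ) t with h3 | h3
    · rw [hp, min_eq_left h3, max_eq_right h3]
    · rw [hp, min_eq_right h3, max_eq_left h3, div_self ht.ne', div_self (ht.trans_le h3).ne']

/-- An integrated form of `-(f**)' = (f** - f*) / t`. -/
theorem maxAvg_le_add (f : α → ℝ≥0∞) {t a : ℝ} (ht : 0 < t) (hta : t ≤ a) :
    maxAvg μ f t ≤ maxAvg μ f a + ∫⁻ r in Ioo t a,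
      (∫⁻ s in Ioi (0 : ℝ) ∩ {s | μ {x | ENNReal.ofReal s < f x} < ENNReal.ofReal r},
        μ {x | ENNReal.ofReal s < f x}) * (ENNReal.ofReal (r ^ 2))⁻¹ := by
  have ha := ht.trans_le hta
  set m : ℝ → ℝ≥0∞ := fun s => μ {x | ENNReal.ofReal s < f x} with hm
  have hanti : Antitone m := fun s s' h =>
    antitone_measure_superlevel f (ENNReal.ofReal_le_ofReal h)
  have hmm := hanti.measurable
  have hti : ∀ t : ℝ, 0 < t → maxAvg μ f t =
      ∫⁻ s in Ioi (0 : ℝ), min (m s) (ENNReal.ofReal t) / ENNReal.ofReal t := by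
    intro t ht
    simp only [maxAvg, setLIntegral_rearr, div_eq_mul_inv]
    rw [lintegral_mul_const' _ _ (by simpa using ht)]
  have hms : ∀ r, MeasurableSet {s | m s < ENNReal.ofReal r} := fun r =>
    measurableSet_lt hmm measurable_const
  have hS : MeasurableSet {p : ℝ × ℝ | m p.1 < ENNReal.ofReal p.2} :=
    measurableSet_lt (hmm.comp measurable_fst) (ENNReal.measurable_ofReal.comp measurable_snd)
  have hmeas : Measurable ({p : ℝ × ℝ | m p.1 < ENNReal.ofReal p.2}.indicator
      fun p => m p.1 * (ENNReal.ofReal (p.2 ^ 2))⁻¹) := by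
    refine Measurable.indicator ?_ hS
    exact (hmm.comp measurable_fst).mul
      (ENNReal.measurable_ofReal.comp (measurable_snd.pow_const 2)).inv
  have hswap : ∫⁻ r in Ioo t a, (∫⁻ s in Ioi (0 : ℝ) ∩ {s | m s < ENNReal.ofReal r}, m s) *
        (ENNReal.ofReal (r ^ 2))⁻¹ =
      ∫⁻ s in Ioi (0 : ℝ), ∫⁻ r in Ioo t a, {r : ℝ | m s < ENNReal.ofReal r}.indicator
        (fun r => m s * (ENNReal.ofReal (r ^ 2))⁻¹) r := by
    refine Eq.trans ?_ (lintegral_lintegral_swap (f := fun r s =>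
      {p : ℝ × ℝ | m p.1 < ENNReal.ofReal p.2}.indicator
      (fun p => m p.1 * (ENNReal.ofReal (p.2 ^ 2))⁻¹) (s, r)) ?_)
    · refine setLIntegral_congr_fun measurableSet_Ioo fun r hr => ?_
      have hr0 : 0 < r := ht.trans hr.1
      have : (ENNReal.ofReal (r ^ 2))⁻¹ ≠ ∞ := by
        simp [hr0.ne']
      rw [← lintegral_mul_const' _ _ this, inter_comm, ← Measure.restrict_restrict (hms r),
        ← lintegral_indicator (hms r)]
      rfl
    · exact (hmeas.comp measurable_swap).aemeasurable
  rw [hswap, hti t ht, hti a ha, ← lintegral_add_left]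
  · exact lintegral_mono fun s => min_div_le ht hta (m s)
  · exact (hmm.min measurable_const).div_const _

end Rearrangement

/-! ### Coarea inequality from Minkowski content. -/

section Coarea

/-- With `x` fixed, a level `s` counted here satisfies `u x ≤ s < u x + r * h`. After Tonelli this
turns the measure of thin layers around superlevel sets into a bound by the slope. -/
theorem volume_thickening_superlevel_section_le {E : Type*} [PseudoMetricSpace E] {Ω : Set E}
    {u : E → ℝ} {x : E} {r h : ℝ} (hx : x ∈ Ω)
    (hr : 0 ≤ r) (hbd : ∀ y ∈ Ω, dist x y < h → u y ≤ u x + r * dist x y) (σ : ℝ) :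
    volume.restrict (Ioi σ) {s : ℝ | x ∈ Metric.thickening h {x | x ∈ Ω ∧ s < u x} \
      {x | x ∈ Ω ∧ s < u x}} / ENNReal.ofReal h ≤ ENNReal.ofReal r := by
  refine ENNReal.div_le_of_le_mul ?_
  rw [← ENNReal.ofReal_mul hr]
  refine (Measure.restrict_apply_le _ _).trans
    ((measure_mono (t := Ico (u x) (u x + r * h)) ?_).trans (by simp))
  rintro s ⟨h1, h2⟩
  obtain ⟨y, ⟨hy, hs⟩, hd⟩ := Metric.mem_thickening_iff.1 h1
  refine ⟨not_lt.1 fun h3 => h2 ⟨hx, h3⟩, hs.trans_le ((hbd y hy hd).trans ?_)⟩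
  gcongr

variable {E : Type*} [PseudoMetricSpace E] [MeasurableSpace E] [BorelSpace E]
  {μ : Measure E} [IsFiniteMeasure μ] {Ω : Set E}

/-- Passing to a sequence of radii can only raise the liminf, and Fatou's lemma is applied along a
sequence. -/
theorem minkowskiContent_le_liminf (A : Set E) (hA : MeasurableSet A) :
    minkowskiContent μ A ≤ liminf (fun n : ℕ => μ (Metric.thickening (1 / ((n : ℝ) + 1)) A \ A) /
      ENNReal.ofReal (1 / ((n : ℝ) + 1))) atTop := by
  have hlim : Tendsto (fun n : ℕ => 1 / ((n : ℝ) + 1)) atTop (𝓝[>] 0) :=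
    tendsto_nhdsWithin_iff.2 ⟨tendsto_one_div_add_atTop_nhds_zero_nat,
      Eventually.of_forall fun n => by simp only [mem_Ioi]; positivity⟩
  refine (liminf_le_liminf_of_le (u := fun h : ℝ => (μ (Metric.thickening h A) - μ A) /
    ENNReal.ofReal h) hlim).trans (le_of_eq ?_)
  change liminf (fun n : ℕ => (μ (Metric.thickening (1 / ((n : ℝ) + 1)) A) - μ A) /
    ENNReal.ofReal (1 / ((n : ℝ) + 1))) atTop = _
  congr 1
  ext n
  rw [measure_sdiff (Metric.self_subset_thickening (by positivity) A) hA.nullMeasurableSet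
    (measure_ne_top _ _)]

/-- Joint measurability for Tonelli: the thickened part is a union of open products of balls and
half-lines, and the part removed is open. -/
theorem measurableSet_thickening_superlevel (hΩ : IsOpen Ω) {u : E → ℝ} (hu : Continuous u)
    (h : ℝ) : MeasurableSet {p : E × ℝ | p.1 ∈ Metric.thickening h {x | x ∈ Ω ∧ p.2 < u x} \
      {x | x ∈ Ω ∧ p.2 < u x}} := by
  have h1 : IsOpen {p : E × ℝ | p.1 ∈ Metric.thickening h {x | x ∈ Ω ∧ p.2 < u x}} := by
    have : {p : E × ℝ | p.1 ∈ Metric.thickening h {x | x ∈ Ω ∧ p.2 < u x}} =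
        ⋃ y ∈ Ω, Metric.ball y h ×ˢ Iio (u y) := by
      ext p
      simp only [Metric.mem_thickening_iff, mem_ofPred_eq, mem_iUnion, mem_prod, Metric.mem_ball,
        mem_Iio]
      constructor
      · rintro ⟨y, ⟨hy, h1⟩, h2⟩
        exact ⟨y, hy, h2, h1⟩
      · rintro ⟨y, hy, h2, h1⟩
        exact ⟨y, ⟨hy, h1⟩, h2⟩
    rw [this]
    exact isOpen_biUnion fun y _ => Metric.isOpen_ball.prod isOpen_Iio
  have h2 : IsOpen {p : E × ℝ | p.1 ∈ Ω ∧ p.2 < u p.1} :=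
    (hΩ.preimage continuous_fst).inter (isOpen_lt continuous_snd (hu.comp continuous_fst))
  exact h1.measurableSet.diff h2.measurableSet

/-- Coarea inequality for a globally Lipschitz function, above the level `σ`. -/
theorem setLIntegral_isoProfile_le_of_lipschitzWith (hΩ : IsOpen Ω) (hμ : μ Ωᶜ = 0)
    {u g : E → ℝ} {K : ℝ≥0} (hu : LipschitzWith K u) (hg0 : ∀ x, 0 ≤ g x)
    (hg : ∀ x ∈ Ω, ∀ r, g x < r → ∀ᶠ y in 𝓝 x, u y ≤ u x + r * dist x y) (σ : ℝ) :
    ∫⁻ s in Ioi σ, isoProfile Ω μ (μ.real {x | x ∈ Ω ∧ s < u x}) ≤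
      ∫⁻ x in {x | x ∈ Ω ∧ σ ≤ u x}, ENNReal.ofReal (g x) ∂μ := by
  set h : ℕ → ℝ := fun n => 1 / ((n : ℝ) + 1) with hdef
  have hpos : ∀ n, 0 < h n := fun n => by simp only [hdef]; positivity
  have hlim : Tendsto h atTop (𝓝 0) := tendsto_one_div_add_atTop_nhds_zero_nat
  set S : ℕ → Set (E × ℝ) := fun n => {p : E × ℝ |
    p.1 ∈ Metric.thickening (h n) {x | x ∈ Ω ∧ p.2 < u x} \ {x | x ∈ Ω ∧ p.2 < u x}} with hSdef
  have hS : ∀ n, MeasurableSet (S n) := fun n =>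
    measurableSet_thickening_superlevel hΩ hu.continuous (h n)
  set φ : ℕ → E → ℝ≥0∞ := fun n x =>
    volume.restrict (Ioi σ) (Prod.mk x ⁻¹' S n) / ENNReal.ofReal (h n) with hφ
  have hAm : ∀ s, MeasurableSet {x | x ∈ Ω ∧ s < u x} := fun s =>
    (hΩ.inter (isOpen_lt continuous_const hu.continuous)).measurableSet
  have hBm : MeasurableSet {x | x ∈ Ω ∧ σ ≤ u x} :=
    hΩ.measurableSet.inter (isClosed_le continuous_const hu.continuous).measurableSet
  have hae : ∀ᵐ x ∂μ, x ∈ Ω := hμ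
  -- The global Lipschitz constant is the integrable majorant for the reverse Fatou lemma.
  have hφK : ∀ n, φ n ≤ᵐ[μ] fun _ => ENNReal.ofReal K := by
    intro n
    filter_upwards [hae] with x hx
    refine volume_thickening_superlevel_section_le hx K.coe_nonneg (fun y _ _ => ?_) σ
    have := (le_abs_self _).trans (hu.dist_le_mul y x)
    rw [dist_comm y x] at this
    linarith
  have hφlim : ∀ x ∈ Ω, limsup (fun n => φ n x) atTop ≤
      {x | x ∈ Ω ∧ σ ≤ u x}.indicator (fun x => ENNReal.ofReal (g x)) x := by
    intro x hx
    by_cases hux : σ ≤ u x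
    · rw [indicator_of_mem (show x ∈ {x | x ∈ Ω ∧ σ ≤ u x} from ⟨hx, hux⟩)]
      refine ENNReal.le_of_forall_pos_le_add fun ε hε _ => ?_
      have hr : g x < g x + ε := by simpa using hε
      have hle : ENNReal.ofReal (g x) + ε = ENNReal.ofReal (g x + ε) := by
        rw [ENNReal.ofReal_add (hg0 x) ε.coe_nonneg, ENNReal.ofReal_coe_nnreal]
      rw [hle]
      obtain ⟨δ, hδ, hball⟩ := Metric.eventually_nhds_iff.1 (hg x hx _ hr)
      refine limsup_le_of_le (by isBoundedDefault) ?_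
      filter_upwards [hlim.eventually (gt_mem_nhds hδ)] with n hn
      refine volume_thickening_superlevel_section_le hx
        (add_nonneg (hg0 x) ε.coe_nonneg) (fun y _ hy => ?_) σ
      exact hball (by rw [dist_comm]; exact hy.trans hn)
    -- Below `σ`, once `u x + K * h n < σ` no level above `σ` is reached within distance `h n` of
    -- `x`.
    · push Not at hux
      refine (limsup_le_of_le (by isBoundedDefault) ?_).trans zero_le
      have hlim' : Tendsto (fun n => u x + K * h n) atTop (𝓝 (u x)) := by
        simpa using (hlim.const_mul (K : ℝ)).const_add (u x)
      filter_upwards [hlim'.eventually (gt_mem_nhds hux)] with n hn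
      have hemp : Prod.mk x ⁻¹' S n ∩ Ioi σ = ∅ := by
        refine eq_empty_of_forall_notMem ?_
        rintro s ⟨⟨h1, -⟩, h2⟩
        obtain ⟨y, ⟨hy, hs⟩, hd⟩ := Metric.mem_thickening_iff.1 h1
        have h3 := (le_abs_self _).trans (hu.dist_le_mul y x)
        rw [dist_comm y x] at h3
        have h4 : (K : ℝ) * dist x y ≤ K * h n := by gcongr
        simp only [mem_Ioi] at h2 hs
        linarith
      simp only [hφ]
      rw [Measure.restrict_apply (measurable_prodMk_left (hS n)), hemp]
      simp
  have hmr : ∀ n, Measurable fun s => μ ((fun x => (x, s)) ⁻¹' S n) / ENNReal.ofReal (h n) :=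
    fun n => (measurable_measure_prodMk_right (hS n)).div_const _
  have hml : ∀ n, Measurable (φ n) :=
    fun n => (measurable_measure_prodMk_left (hS n)).div_const _
  have htonelli : ∀ n, ∫⁻ s in Ioi σ, μ ((fun x => (x, s)) ⁻¹' S n) / ENNReal.ofReal (h n) =
      ∫⁻ x, φ n x ∂μ := by
    intro n
    have hne : (ENNReal.ofReal (h n))⁻¹ ≠ ∞ := by simpa using hpos n
    simp only [hφ, div_eq_mul_inv]
    rw [lintegral_mul_const' _ _ hne, lintegral_mul_const' _ _ hne,
      ← Measure.prod_apply (hS n), ← Measure.prod_apply_symm (hS n)]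
  have hmink : ∀ s, minkowskiContent μ {x | x ∈ Ω ∧ s < u x} ≤
      liminf (fun n => μ ((fun x => (x, s)) ⁻¹' S n) / ENNReal.ofReal (h n)) atTop :=
    fun s => minkowskiContent_le_liminf _ (hAm s)
  clear_value φ S
  calc ∫⁻ s in Ioi σ, isoProfile Ω μ (μ.real {x | x ∈ Ω ∧ s < u x})
      ≤ ∫⁻ s in Ioi σ, liminf (fun n => μ ((fun x => (x, s)) ⁻¹' S n) / ENNReal.ofReal (h n))
          atTop := by
        refine lintegral_mono fun s => ?_
        refine le_trans (sInf_le ?_) (hmink s)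
        exact ⟨_, fun x hx => hx.1, hAm s, by simp, rfl⟩
    _ ≤ liminf (fun n => ∫⁻ s in Ioi σ, μ ((fun x => (x, s)) ⁻¹' S n) / ENNReal.ofReal (h n))
          atTop :=
        lintegral_liminf_le hmr
    _ = liminf (fun n => ∫⁻ x, φ n x ∂μ) atTop := by
        simp_rw [htonelli]
    -- Fatou was used in the level variable; reverse Fatou comes next, in the space variable.
    _ ≤ limsup (fun n => ∫⁻ x, φ n x ∂μ) atTop := liminf_le_limsup
    _ ≤ ∫⁻ x, limsup (fun n => φ n x) atTop ∂μ :=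
        limsup_lintegral_le _ hml hφK
          (by simp [lintegral_const, ENNReal.mul_eq_top])
    _ ≤ ∫⁻ x, {x | x ∈ Ω ∧ σ ≤ u x}.indicator (fun x => ENNReal.ofReal (g x)) x ∂μ := by
        refine lintegral_mono_ae ?_
        filter_upwards [hae] with x hx using hφlim x hx
    _ = _ := lintegral_indicator hBm _

/-- Approaching `σ` from above removes the level set `{u = σ}`, which the limiting argument above
leaves in the domain of integration. -/
theorem setLIntegral_Ioi_le_of_forall_gt {F : ℝ → ℝ≥0∞} {σ : ℝ} {B : ℝ≥0∞}
    (h : ∀ τ, σ < τ → ∫⁻ s in Ioi τ, F s ≤ B) : ∫⁻ s in Ioi σ, F s ≤ B := by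
  have hU : Ioi σ = ⋃ n : ℕ, Ioi (σ + 1 / ((n : ℝ) + 1)) := by
    ext s
    simp only [mem_Ioi, mem_iUnion]
    constructor
    · intro hs
      obtain ⟨n, hn⟩ := exists_nat_one_div_lt (sub_pos.2 hs)
      exact ⟨n, by linarith⟩
    · rintro ⟨n, hn⟩
      have : 0 < 1 / ((n : ℝ) + 1) := by positivity
      linarith
  rw [hU, setLIntegral_iUnion_of_directed]
  · exact iSup_le fun n => h _ (by simp only [lt_add_iff_pos_right]; positivity)
  · refine Monotone.directed_le fun i j hij => Ioi_subset_Ioi ?_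
    gcongr

/-- Coarea inequality: `∫_σ^∞ I(μ{u > s}) ds ≤ ∫_{u > σ} g dμ` if `g` bounds the local slope
of `u`. -/
theorem setLIntegral_isoProfile_le (hΩ : IsOpen Ω) (hμ : μ Ωᶜ = 0)
    {u g : E → ℝ} {K : ℝ≥0} (hu : LipschitzOnWith K u Ω) (hg0 : ∀ x, 0 ≤ g x)
    (hg : ∀ x ∈ Ω, ∀ r, g x < r → ∀ᶠ y in 𝓝 x, u y ≤ u x + r * dist x y) (σ : ℝ) :
    ∫⁻ s in Ioi σ, isoProfile Ω μ (μ.real {x | s < u x}) ≤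
      ∫⁻ x in {x | σ < u x}, ENNReal.ofReal (g x) ∂μ := by
  -- A global Lipschitz extension changes `u` only off `Ω`, a null set; openness of `Ω` preserves
  -- the local slope bound at its points.
  obtain ⟨v, hv, huv⟩ := hu.extend_real
  have hae : ∀ᵐ x ∂μ, x ∈ Ω := hμ
  have hset : ∀ s, {x | s < u x} =ᵐ[μ] {x | x ∈ Ω ∧ s < v x} := by
    intro s
    filter_upwards [hae] with x hx
    exact propext ⟨fun h => ⟨hx, huv hx ▸ h⟩, fun h => by
      have h2 : s < v x := h.2
      rw [← huv hx] at h2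
      exact h2⟩
  have hgv : ∀ x ∈ Ω, ∀ r, g x < r → ∀ᶠ y in 𝓝 x, v y ≤ v x + r * dist x y := by
    intro x hx r hr
    filter_upwards [hg x hx r hr, hΩ.mem_nhds hx] with y hy hyΩ
    rwa [← huv hx, ← huv hyΩ]
  simp_rw [fun s => measureReal_congr (hset s)]
  rw [setLIntegral_congr (hset σ)]
  refine setLIntegral_Ioi_le_of_forall_gt fun τ hτ => ?_
  refine (setLIntegral_isoProfile_le_of_lipschitzWith hΩ hμ hv hg0 hgv τ).trans ?_
  exact lintegral_mono_set fun x hx => ⟨hx.1, hτ.trans_le hx.2⟩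

end Coarea

/-! ### From coarea to a bound for maximal averages. -/

section Symmetrization

/-- Concavity and `I 0 = 0` make `I(t)/t` nonincreasing; the product form avoids dividing by zero.
-/
theorem IsStandardProfile.ofReal_mul_le {I : ℝ → ℝ≥0∞} {M : ℝ} (hI : IsStandardProfile I M)
    {m r : ℝ} (hm : 0 ≤ m) (hmr : m ≤ r) (hr : r ≤ M) :
    ENNReal.ofReal m * I r ≤ ENNReal.ofReal r * I m := by
  rcases hm.eq_or_lt with rfl | hm0
  · simp
  have hr0 : 0 < r := hm0.trans_le hmr
  have h := hI.concaveOn.2 (⟨le_rfl, hr0.le.trans hr⟩ : (0 : ℝ) ∈ Icc 0 M)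
    (⟨hr0.le, hr⟩ : r ∈ Icc 0 M)
    (sub_nonneg.2 ((div_le_one hr0).2 hmr)) (div_nonneg hm hr0.le) (sub_add_cancel 1 _)
  simp only [smul_eq_mul, mul_zero, zero_add, hI.zero, ENNReal.toReal_zero] at h
  rw [div_mul_cancel₀ _ hr0.ne'] at h
  rw [← ENNReal.ofReal_toReal (hI.ne_top r ⟨hr0.le, hr⟩),
    ← ENNReal.ofReal_toReal (hI.ne_top m ⟨hm, hmr.trans hr⟩), ← ENNReal.ofReal_mul hm,
    ← ENNReal.ofReal_mul hr0.le]
  refine ENNReal.ofReal_le_ofReal ?_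
  calc m * (I r).toReal = r * (m / r * (I r).toReal) := by field_simp
    _ ≤ _ := by gcongr

variable {E : Type*} [PseudoMetricSpace E] [MeasurableSpace E] [BorelSpace E]
  {μ : Measure E} [IsFiniteMeasure μ] {Ω : Set E}

/-- All levels involved lie above their infimum `σ`, and right-continuity of the distribution
function gives `μ{u > σ} ≤ r`. Coarea above `σ` and Hardy–Littlewood on `{u > σ}` then apply. -/
theorem setLIntegral_isoProfile_le_setLIntegral_rearr (hΩ : IsOpen Ω) (hμ : μ Ωᶜ = 0)
    {u g : E → ℝ} {K : ℝ≥0} (hu : LipschitzOnWith K u Ω) (hg0 : ∀ x, 0 ≤ g x)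
    (hgm : AEMeasurable g μ)
    (hg : ∀ x ∈ Ω, ∀ r, g x < r → ∀ᶠ y in 𝓝 x, u y ≤ u x + r * dist x y) (r : ℝ) :
    ∫⁻ s in Ioi (0 : ℝ) ∩
        {s | μ {x | ENNReal.ofReal s < ENNReal.ofReal (u x)} < ENNReal.ofReal r},
      isoProfile Ω μ (μ.real {x | s < u x}) ≤
      ∫⁻ s in Ioo 0 r, rearr μ (fun x => ENNReal.ofReal (g x)) s := by
  set S := Ioi (0 : ℝ) ∩
    {s | μ {x | ENNReal.ofReal s < ENNReal.ofReal (u x)} < ENNReal.ofReal r} with hS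
  rcases S.eq_empty_or_nonempty with h | hne
  · simp [h]
  have hbdd : BddBelow S := ⟨0, fun s hs => le_of_lt hs.1⟩
  have hσ0 : 0 ≤ sInf S := le_csInf hne fun s hs => le_of_lt hs.1
  have hsub : S ⊆ Ici (sInf S) := fun s hs => csInf_le hbdd hs
  refine (lintegral_mono_set hsub).trans ?_
  rw [setLIntegral_congr Ioi_ae_eq_Ici.symm]
  refine (setLIntegral_isoProfile_le hΩ hμ hu hg0 hg _).trans ?_
  refine setLIntegral_le_setLIntegral_rearr hg0 hgm ?_
  refine (measure_mono fun x hx =>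
    (ENNReal.ofReal_lt_ofReal_iff_of_nonneg hσ0).2 hx).trans
      (measure_superlevel_le_of_forall_gt (f := fun x => ENNReal.ofReal (u x)) fun t' ht' => ?_)
  obtain ⟨s, hs, hst⟩ : ∃ s ∈ S, ENNReal.ofReal s ≤ t' := by
    rcases eq_or_ne t' ∞ with rfl | htop
    · exact ⟨_, hne.some_mem, le_top⟩
    · rw [ENNReal.ofReal_lt_iff_lt_toReal hσ0 htop] at ht'
      obtain ⟨s, hs, hlt⟩ := exists_lt_of_csInf_lt hne ht'
      exact ⟨s, hs, ENNReal.ofReal_le_of_le_toReal hlt.le⟩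
  exact (antitone_measure_superlevel _ hst).trans hs.2.le

theorem mul_inv_sq_le_div_div {i P G : ℝ≥0∞} {r : ℝ} (hr : 0 < r) (hi0 : i ≠ 0) (hi : i ≠ ∞)
    (h : P * i ≤ ENNReal.ofReal r * G) :
    P * (ENNReal.ofReal (r ^ 2))⁻¹ ≤ G / ENNReal.ofReal r / i := by
  have h0 : ENNReal.ofReal r ≠ 0 := by simpa using hr
  rw [ENNReal.le_div_iff_mul_le (Or.inl hi0) (Or.inl hi), mul_right_comm,
    ENNReal.ofReal_pow hr.le]
  calc P * i * (ENNReal.ofReal r ^ 2)⁻¹ ≤ ENNReal.ofReal r * G * (ENNReal.ofReal r ^ 2)⁻¹ := by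
        gcongr
    _ = G / ENNReal.ofReal r * (ENNReal.ofReal r * (ENNReal.ofReal r)⁻¹) := by
        rw [ENNReal.inv_pow, div_eq_mul_inv]; ring
    _ = G / ENNReal.ofReal r := by rw [ENNReal.mul_inv_cancel h0 ENNReal.ofReal_ne_top, mul_one]

/-- Symmetrization inequality:
`u**(t) ≤ u**(a) + ∫_t^a g**(r) / I(r) dr` if `g` bounds the local slope of `u`. -/
theorem maxAvg_le_add_lintegral_div (hΩ : IsOpen Ω) (hμ : μ Ωᶜ = 0)
    (hI : IsStandardProfile (isoProfile Ω μ) (μ.real univ)) {a : ℝ} (haM : a ≤ μ.real univ)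
    (hI0 : ∀ r ∈ Ioo 0 a, isoProfile Ω μ r ≠ 0)
    {u g : E → ℝ} {K : ℝ≥0} (hu : LipschitzOnWith K u Ω) (hg0 : ∀ x, 0 ≤ g x)
    (hgm : AEMeasurable g μ)
    (hg : ∀ x ∈ Ω, ∀ r, g x < r → ∀ᶠ y in 𝓝 x, u y ≤ u x + r * dist x y)
    {t : ℝ} (ht : 0 < t) (hta : t ≤ a) :
    maxAvg μ (fun x => ENNReal.ofReal (u x)) t ≤ maxAvg μ (fun x => ENNReal.ofReal (u x)) a +
      ∫⁻ r in Ioo t a, maxAvg μ (fun x => ENNReal.ofReal (g x)) r / isoProfile Ω μ r := by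
  refine (maxAvg_le_add _ ht hta).trans (add_le_add_right ?_ _)
  refine setLIntegral_mono' measurableSet_Ioo fun r hr => ?_
  have hr0 : 0 < r := ht.trans hr.1
  have hrM : r ≤ μ.real univ := hr.2.le.trans haM
  have hitop := hI.ne_top r ⟨hr0.le, hrM⟩
  refine mul_inv_sq_le_div_div hr0 (hI0 r ⟨hr0, hr.2⟩) hitop ?_
  refine le_trans ?_ (mul_le_mul_right (setLIntegral_isoProfile_le_setLIntegral_rearr hΩ hμ hu hg0
    hgm hg r) _)
  rw [← lintegral_mul_const' _ _ hitop, ← lintegral_const_mul' _ _ ENNReal.ofReal_ne_top]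
  have hanti : Antitone fun s : ℝ => μ {x | ENNReal.ofReal s < ENNReal.ofReal (u x)} :=
    fun s s' h => antitone_measure_superlevel _ (ENNReal.ofReal_le_ofReal h)
  refine setLIntegral_mono' (measurableSet_Ioi.inter
    (measurableSet_lt hanti.measurable measurable_const)) fun s hs => ?_
  have hset : {x | ENNReal.ofReal s < ENNReal.ofReal (u x)} = {x | s < u x} := by
    ext x
    exact ENNReal.ofReal_lt_ofReal_iff_of_nonneg (le_of_lt hs.1)
  have hlt := hs.2
  simp only [mem_ofPred_eq] at hlt
  rw [hset] at hlt ⊢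
  rw [← ofReal_measureReal]
  exact hI.ofReal_mul_le measureReal_nonneg (ENNReal.toReal_le_of_le_ofReal hr0.le hlt.le) hrM

end Symmetrization

/-! ### Iterated Hardy integrals against `dz / I(z)`. -/

section Hardy

theorem measurable_measure_Iio (ν : Measure ℝ) : Measurable fun u => ν (Iio u) :=
  Monotone.measurable fun _ _ h => measure_mono (Iio_subset_Iio h)

/-- Tonelli, with `ν(Iio u) ≤ ν(Iio v)` for `u < v`: each further integration costs one power of
`ν(Iio v)`. No sharp constant is sought. -/
theorem lintegral_mul_setLIntegral_Ioi_le (ν : Measure ℝ) [SFinite ν] {f : ℝ → ℝ≥0∞}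
    (hf : Measurable f) (k : ℕ) :
    ∫⁻ u, (∫⁻ v in Ioi u, f v ∂ν) * ν (Iio u) ^ k ∂ν ≤ ∫⁻ v, f v * ν (Iio v) ^ (k + 1) ∂ν := by
  have hF := measurable_measure_Iio ν
  have hS : MeasurableSet {p : ℝ × ℝ | p.1 < p.2} := measurableSet_lt measurable_fst measurable_snd
  calc ∫⁻ u, (∫⁻ v in Ioi u, f v ∂ν) * ν (Iio u) ^ k ∂ν
      ≤ ∫⁻ u, ∫⁻ v, {p : ℝ × ℝ | p.1 < p.2}.indicator (fun p => f p.2 * ν (Iio p.2) ^ k) (u, v)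
          ∂ν ∂ν := by
        refine lintegral_mono fun u => ?_
        rw [← lintegral_mul_const _ hf, ← lintegral_indicator measurableSet_Ioi]
        refine lintegral_mono fun v => ?_
        by_cases h : u < v
        · rw [indicator_of_mem (show v ∈ Ioi u from h),
            indicator_of_mem (show (u, v) ∈ {p : ℝ × ℝ | p.1 < p.2} from h)]
          gcongr
        · rw [indicator_of_notMem (show v ∉ Ioi u from h)]
          exact zero_le
    _ = ∫⁻ v, ∫⁻ u, {p : ℝ × ℝ | p.1 < p.2}.indicator (fun p => f p.2 * ν (Iio p.2) ^ k) (u, v)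
          ∂ν ∂ν := by
        refine lintegral_lintegral_swap (Measurable.aemeasurable ?_)
        exact ((hf.comp measurable_snd).mul ((hF.comp measurable_snd).pow_const k)).indicator hS
    _ = _ := by
        refine lintegral_congr fun v => ?_
        have : ∀ u, {p : ℝ × ℝ | p.1 < p.2}.indicator (fun p => f p.2 * ν (Iio p.2) ^ k) (u, v) =
            (Iio v).indicator (fun _ => f v * ν (Iio v) ^ k) u := fun u => rfl
        simp_rw [this]
        rw [lintegral_indicator_const measurableSet_Iio, pow_succ, mul_assoc]

/-- A crude form of `∫ F^k dF = F^(k+1)/(k+1)` that also permits infinite mass. It bounds powers of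
`ν(t, a)` by `T` applied to `1`. -/
theorem measure_univ_pow_le (ν : Measure ℝ) [SFinite ν] [NullSingletonClass ν] (k : ℕ) :
    ν univ ^ (k + 1) ≤ 2 ^ k * ∫⁻ u, ν (Iio u) ^ k ∂ν := by
  have hF := measurable_measure_Iio ν
  induction k with
  | zero => simp
  | succ k ih =>
    have hS : MeasurableSet {p : ℝ × ℝ | p.1 < p.2} :=
      measurableSet_lt measurable_fst measurable_snd
    have h1 : (∫⁻ u, ν (Iio u) ^ k ∂ν) * ν univ ≤ 2 * ∫⁻ u, ν (Iio u) ^ (k + 1) ∂ν := by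
      calc (∫⁻ u, ν (Iio u) ^ k ∂ν) * ν univ = ∫⁻ _, ∫⁻ u, ν (Iio u) ^ k ∂ν ∂ν := by
            rw [lintegral_const]
        -- Split at `w`: for `u ≤ w` the integrand is at most its value at `w`, and absence of atoms
        -- identifies `ν(Iic w)` with `ν(Iio w)`.
        _ ≤ ∫⁻ w, ((∫⁻ u in Ioi w, ν (Iio u) ^ k ∂ν) + ν (Iio w) ^ (k + 1)) ∂ν := by
            refine lintegral_mono fun w => ?_
            rw [← lintegral_add_compl _ (measurableSet_Ioi (a := w)), compl_Ioi]
            refine add_le_add_right ?_ _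
            calc ∫⁻ u in Iic w, ν (Iio u) ^ k ∂ν ≤ ∫⁻ u in Iic w, ν (Iio w) ^ k ∂ν :=
                  setLIntegral_mono' measurableSet_Iic fun u hu => by
                    gcongr
                    exact hu
              _ = ν (Iio w) ^ (k + 1) := by
                  rw [setLIntegral_const, ← measure_congr Iio_ae_eq_Iic, pow_succ]
        _ = (∫⁻ w, (∫⁻ u in Ioi w, ν (Iio u) ^ k ∂ν) * ν (Iio w) ^ 0 ∂ν) +
              ∫⁻ w, ν (Iio w) ^ (k + 1) ∂ν := by
            rw [lintegral_add_right _ (hF.pow_const _)]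
            simp
        _ ≤ (∫⁻ u, ν (Iio u) ^ k * ν (Iio u) ^ (0 + 1) ∂ν) + ∫⁻ w, ν (Iio w) ^ (k + 1) ∂ν :=
            add_le_add_left (lintegral_mul_setLIntegral_Ioi_le ν (hF.pow_const k) 0) _
        _ = _ := by
            simp_rw [zero_add, pow_one, ← pow_succ]
            rw [two_mul]
    calc ν univ ^ (k + 1 + 1) = ν univ ^ (k + 1) * ν univ := pow_succ _ _
      _ ≤ 2 ^ k * (∫⁻ u, ν (Iio u) ^ k ∂ν) * ν univ := by gcongr
      _ ≤ 2 ^ k * (2 * ∫⁻ u, ν (Iio u) ^ (k + 1) ∂ν) := by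
          rw [mul_assoc]
          gcongr
      _ = _ := by rw [pow_succ, mul_assoc]

/-- Iteration of the one-step inequality `D k ≤ A k + ∫ D (k + 1)`. -/
theorem le_lintegral_add_sum (ν : Measure ℝ) [SFinite ν] {D : ℕ → ℝ → ℝ≥0∞}
    (hD : ∀ k, Measurable (D k)) {A : ℕ → ℝ≥0∞} {x : ℝ≥0∞} {N : ℕ}
    (h0 : x ≤ A 0 + ∫⁻ u, D 1 u ∂ν)
    (h : ∀ k < N, ∀ᵐ u ∂ν, D (k + 1) u ≤ A (k + 1) + ∫⁻ v in Ioi u, D (k + 2) v ∂ν) :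
    x ≤ (∫⁻ u, D (N + 1) u * ν (Iio u) ^ N ∂ν) +
      ∑ i ∈ Finset.range (N + 1), A i * ν univ ^ i := by
  have hF := measurable_measure_Iio ν
  induction N with
  | zero => simpa [add_comm] using h0
  | succ N ih =>
    refine (ih fun k hk => h k (hk.trans N.lt_succ_self)).trans ?_
    rw [Finset.sum_range_succ _ (N + 1), ← add_assoc, add_right_comm]
    refine add_le_add_left ?_ _
    calc ∫⁻ u, D (N + 1) u * ν (Iio u) ^ N ∂ν
        ≤ ∫⁻ u, ((∫⁻ v in Ioi u, D (N + 2) v ∂ν) * ν (Iio u) ^ N +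
            A (N + 1) * ν (Iio u) ^ N) ∂ν := by
          refine lintegral_mono_ae ?_
          filter_upwards [h N N.lt_succ_self] with u hu
          rw [← add_mul, add_comm (∫⁻ v in Ioi u, D (N + 2) v ∂ν)]
          gcongr
      _ = (∫⁻ u, (∫⁻ v in Ioi u, D (N + 2) v ∂ν) * ν (Iio u) ^ N ∂ν) +
            ∫⁻ u, A (N + 1) * ν (Iio u) ^ N ∂ν :=
          lintegral_add_right _ ((hF.pow_const N).const_mul _)
      _ ≤ _ := by
          refine add_le_add (lintegral_mul_setLIntegral_Ioi_le ν (hD _) N) ?_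
          calc ∫⁻ u, A (N + 1) * ν (Iio u) ^ N ∂ν ≤ ∫⁻ _, A (N + 1) * ν univ ^ N ∂ν := by
                refine lintegral_mono fun u => ?_
                gcongr
                exact subset_univ _
            _ = _ := by rw [lintegral_const, pow_succ, mul_assoc]

/-- The measure `dz / I(z)` on `(t, a)`. -/
noncomputable def hardyMeasure (I : ℝ → ℝ≥0∞) (t a : ℝ) : Measure ℝ :=
  (volume.restrict (Ioo t a)).withDensity fun z => (I z)⁻¹

variable {I : ℝ → ℝ≥0∞} {t a : ℝ}

instance : SFinite (hardyMeasure I t a) := by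
  unfold hardyMeasure
  infer_instance

instance : NullSingletonClass (hardyMeasure I t a) := by
  unfold hardyMeasure
  infer_instance

theorem lintegral_hardyMeasure (hI : AEMeasurable I (volume.restrict (Ioo t a))) {f : ℝ → ℝ≥0∞}
    (hf : Measurable f) : ∫⁻ u, f u ∂hardyMeasure I t a = ∫⁻ u in Ioo t a, f u / I u := by
  have hI' : AEMeasurable (fun z => (I z)⁻¹) (volume.restrict (Ioo t a)) := hI.inv
  rw [hardyMeasure, lintegral_withDensity_eq_lintegral_mul₀ hI' hf.aemeasurable]
  refine lintegral_congr fun u => ?_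
  rw [Pi.mul_apply, mul_comm, div_eq_mul_inv]

theorem hardyMeasure_Iio {u : ℝ} (hu : u ≤ a) :
    hardyMeasure I t a (Iio u) = ∫⁻ z in Ioo t u, (I z)⁻¹ := by
  rw [hardyMeasure, withDensity_apply _ measurableSet_Iio,
    Measure.restrict_restrict measurableSet_Iio]
  congr 2
  ext z
  simp only [mem_inter_iff, mem_Iio, mem_Ioo]
  exact ⟨fun h => ⟨h.2.1, h.1⟩, fun h => ⟨h.2, h.1, h.2.trans_le hu⟩⟩

theorem hardyMeasure_univ : hardyMeasure I t a univ = ∫⁻ z in Ioo t a, (I z)⁻¹ := by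
  rw [hardyMeasure, withDensity_apply _ MeasurableSet.univ, Measure.restrict_univ]

/-- This lets the one-step inequality be restarted from `u` inside the integral begun at `t`. -/
theorem hardyMeasure_restrict_Ioi {u : ℝ} (hu : t ≤ u) :
    (hardyMeasure I t a).restrict (Ioi u) = hardyMeasure I u a := by
  rw [hardyMeasure, restrict_withDensity measurableSet_Ioi,
    Measure.restrict_restrict measurableSet_Ioi, hardyMeasure]
  congr 2
  ext z
  simp only [mem_inter_iff, mem_Ioi, mem_Ioo]
  exact ⟨fun h => ⟨h.1, h.2.2⟩, fun h => ⟨h.1, hu.trans_lt h.1, h.2⟩⟩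

theorem ae_hardyMeasure_mem : ∀ᵐ u ∂hardyMeasure I t a, u ∈ Ioo t a :=
  (withDensity_absolutelyContinuous _ _).ae_le (ae_restrict_mem measurableSet_Ioo)

theorem iteratedHardy_succ_eq_lintegral (hI : AEMeasurable I (volume.restrict (Ioo t a))) {k : ℕ}
    {f : ℝ → ℝ≥0∞} (hf : Measurable f) (ht : t ∈ Ioo 0 a) :
    iteratedHardy I a (k + 1) f t =
      ∫⁻ u, f u * hardyMeasure I t a (Iio u) ^ k ∂hardyMeasure I t a := by
  have hm : Measurable fun u => f u * hardyMeasure I t a (Iio u) ^ k :=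
    hf.mul ((measurable_measure_Iio _).pow_const k)
  rw [lintegral_hardyMeasure hI hm, iteratedHardy, indicator_of_mem ht]
  refine setLIntegral_congr_fun measurableSet_Ioo fun u hu => ?_
  simp only [add_tsub_cancel_right]
  rw [hardyMeasure_Iio hu.2.le, div_eq_mul_inv, div_eq_mul_inv, mul_right_comm]

theorem measurable_iteratedHardy (I : ℝ → ℝ≥0∞) (a : ℝ) (k : ℕ) (f : ℝ → ℝ≥0∞) :
    Measurable (iteratedHardy I a k f) := by
  refine Measurable.indicator (Antitone.measurable fun s t hst => ?_) measurableSet_Ioo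
  refine (lintegral_mono_set (Ioo_subset_Ioo_left hst)).trans (lintegral_mono fun u => ?_)
  gcongr

theorem IsStandardProfile.aemeasurable {M : ℝ} (hI : IsStandardProfile I M) :
    AEMeasurable I (volume.restrict (Icc 0 M)) := by
  have h : AEMeasurable (fun t => ENNReal.ofReal (I t).toReal) (volume.restrict (Icc 0 M)) :=
    (hI.continuousOn.aemeasurable measurableSet_Icc).ennreal_ofReal
  refine h.congr ?_
  filter_upwards [ae_restrict_mem measurableSet_Icc] with t ht
  exact ENNReal.ofReal_toReal (hI.ne_top t ht)

/-- A concave profile that vanishes inside `(0, a)` makes `∫_t^a dz / I(z)` infinite. -/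
theorem IsStandardProfile.hardyMeasure_univ_eq_top {M r : ℝ} (hI : IsStandardProfile I M)
    (haM : a ≤ M) (hr : r ∈ Ioo 0 a) (hIr : I r = 0) (hta : t < a) :
    hardyMeasure I t a univ = ∞ := by
  rw [hardyMeasure_univ, eq_top_iff]
  -- As `I(z)/z` is nonincreasing, a zero at `r` persists to the right, where `1/I` is then
  -- infinite.
  have hz : ∀ z ∈ Ioo (max t r) a, I z = 0 := by
    intro z hz
    have h := hI.ofReal_mul_le hr.1.le ((le_max_right _ _).trans hz.1.le) (hz.2.le.trans haM)
    rw [hIr, mul_zero, nonpos_iff_eq_zero, mul_eq_zero] at h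
    refine h.resolve_left ?_
    simpa using hr.1
  calc ∞ = ∫⁻ _ in Ioo (max t r) a, ∞ := by
        rw [setLIntegral_const, ENNReal.top_mul]
        rw [Real.volume_Ioo, ne_eq, ENNReal.ofReal_eq_zero, not_le, sub_pos]
        exact max_lt hta hr.2
    _ ≤ ∫⁻ z in Ioo (max t r) a, (I z)⁻¹ :=
        setLIntegral_mono' measurableSet_Ioo fun z hzm => by rw [hz z hzm, ENNReal.inv_zero]
    _ ≤ _ := lintegral_mono_set (Ioo_subset_Ioo_left (le_max_left _ _))

end Hardy

/-! ### Symmetrization applied to successive derivatives. -/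

section WeightedMeasure

variable {n : ℕ} {Ω : Set (EuclideanSpace ℝ (Fin n))} {w : EuclideanSpace ℝ (Fin n) → ℝ}

theorem weightedMeasure_absolutelyContinuous : weightedMeasure Ω w ≪ volume.restrict Ω :=
  withDensity_absolutelyContinuous _ _

theorem weightedMeasure_compl (hΩ : MeasurableSet Ω) : weightedMeasure Ω w Ωᶜ = 0 :=
  weightedMeasure_absolutelyContinuous (by rw [Measure.restrict_apply hΩ.compl]; simp)

theorem isFiniteMeasure_weightedMeasure (hw : IntegrableOn w Ω) :
    IsFiniteMeasure (weightedMeasure Ω w) :=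
  isFiniteMeasure_withDensity_ofReal hw.2

variable {f : EuclideanSpace ℝ (Fin n) → ℝ} {k j : ℕ}

theorem derivSize_eq_ofReal :
    derivSize j f = fun x => ENNReal.ofReal ‖iteratedFDeriv ℝ j f x‖ :=
  funext fun _ => (ofReal_norm _).symm

theorem aemeasurable_norm_iteratedFDeriv (hΩ : IsOpen Ω) (hf : ContDiffOn ℝ k f Ω) (hj : j ≤ k) :
    AEMeasurable (fun x => ‖iteratedFDeriv ℝ j f x‖) (weightedMeasure Ω w) := by
  refine AEMeasurable.mono_ac (ContinuousOn.aemeasurable ?_ hΩ.measurableSet)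
    weightedMeasure_absolutelyContinuous
  exact ((hf.continuousOn_iteratedFDerivWithin (by exact_mod_cast hj) hΩ.uniqueDiffOn).congr
    fun x hx => (iteratedFDerivWithin_of_isOpen j hΩ hx).symm).norm

theorem aemeasurable_derivSize (hΩ : IsOpen Ω) (hf : ContDiffOn ℝ k f Ω) (hj : j ≤ k) :
    AEMeasurable (derivSize j f) (weightedMeasure Ω w) := by
  rw [derivSize_eq_ofReal]
  exact (aemeasurable_norm_iteratedFDeriv hΩ hf hj).ennreal_ofReal

/-- The local slope of `|d^j f|` is at most `|d^{j+1} f|`. -/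
theorem eventually_norm_iteratedFDeriv_le (hΩ : IsOpen Ω) (hf : ContDiffOn ℝ k f Ω) (hj : j < k)
    {x : EuclideanSpace ℝ (Fin n)} (hx : x ∈ Ω) {r : ℝ}
    (hr : ‖iteratedFDeriv ℝ (j + 1) f x‖ < r) :
    ∀ᶠ y in 𝓝 x, ‖iteratedFDeriv ℝ j f y‖ ≤ ‖iteratedFDeriv ℝ j f x‖ + r * dist x y := by
  have hd := ((hf.contDiffAt (hΩ.mem_nhds hx)).differentiableAt_iteratedFDeriv
    (by exact_mod_cast hj : (j : WithTop ℕ∞) < k)).hasFDerivAt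
  rw [← norm_fderiv_iteratedFDeriv] at hr
  filter_upwards [hd.isLittleO.bound (sub_pos.2 hr)] with y hy
  have h1 := ContinuousLinearMap.le_opNorm (fderiv ℝ (iteratedFDeriv ℝ j f) x) (y - x)
  have h2 := norm_le_norm_add_norm_sub' (iteratedFDeriv ℝ j f y) (iteratedFDeriv ℝ j f x)
  have h3 := norm_le_norm_add_norm_sub' (iteratedFDeriv ℝ j f y - iteratedFDeriv ℝ j f x)
    (fderiv ℝ (iteratedFDeriv ℝ j f) x (y - x))
  rw [dist_comm, dist_eq_norm]
  linarith

theorem maxAvg_derivSize_le (hΩ : IsOpen Ω) [IsFiniteMeasure (weightedMeasure Ω w)]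
    (hI : IsStandardProfile (isoProfile Ω (weightedMeasure Ω w))
      ((weightedMeasure Ω w).real univ)) {a : ℝ} (haM : a ≤ (weightedMeasure Ω w).real univ)
    (hI0 : ∀ r ∈ Ioo 0 a, isoProfile Ω (weightedMeasure Ω w) r ≠ 0)
    (hf : IsSmoothLip k Ω f) (hj : j < k) {t : ℝ} (ht : 0 < t) (hta : t ≤ a) :
    maxAvg (weightedMeasure Ω w) (derivSize j f) t ≤
      (∫⁻ x, derivSize j f x ∂weightedMeasure Ω w) / ENNReal.ofReal a +
        ∫⁻ r in Ioo t a, maxAvg (weightedMeasure Ω w) (derivSize (j + 1) f) r /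
          isoProfile Ω (weightedMeasure Ω w) r := by
  obtain ⟨K, hK⟩ := hf.2 j hj
  simp only [derivSize_eq_ofReal]
  refine (maxAvg_le_add_lintegral_div hΩ (weightedMeasure_compl hΩ.measurableSet) hI haM hI0 hK
    (fun x => norm_nonneg _) (aemeasurable_norm_iteratedFDeriv hΩ hf.1 (Nat.succ_le_of_lt hj))
    (fun x hx r hr => eventually_norm_iteratedFDeriv_le hΩ hf.1 hj hx hr) ht hta).trans ?_
  refine add_le_add_left (maxAvg_le_lintegral (fun x => norm_nonneg _) ?_ a) _
  exact aemeasurable_norm_iteratedFDeriv hΩ hf.1 hj.le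

/-- Only the top power of `ν(t, a)` then needs to be controlled in the target space. -/
theorem pow_le_one_add_pow {v : ℝ≥0∞} {i k : ℕ} (h : i ≤ k) : v ^ i ≤ 1 + v ^ k := by
  rcases le_total v 1 with hv | hv
  · exact (pow_le_one₀ zero_le hv).trans le_self_add
  · exact (pow_le_pow_right₀ hv h).trans le_add_self

/-- For `t < a`, iterate the one-step bound on maximal averages. For `t ≥ a` the Hardy term
vanishes, and monotonicity of `f*` leaves only `‖f‖₁ / a`. -/
theorem rearr_derivSize_zero_le (hΩ : IsOpen Ω) [IsFiniteMeasure (weightedMeasure Ω w)]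
    (hI : IsStandardProfile (isoProfile Ω (weightedMeasure Ω w))
      ((weightedMeasure Ω w).real univ)) {a : ℝ} (haM : a ≤ (weightedMeasure Ω w).real univ)
    (hI0 : ∀ r ∈ Ioo 0 a, isoProfile Ω (weightedMeasure Ω w) r ≠ 0) (ha : 0 < a)
    (hf : IsSmoothLip (k + 1) Ω f) {t : ℝ} (ht : 0 < t) :
    rearr (weightedMeasure Ω w) (derivSize 0 f) t ≤
      iteratedHardy (isoProfile Ω (weightedMeasure Ω w)) a (k + 1)
        (maxAvg (weightedMeasure Ω w) (derivSize (k + 1) f)) t +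
      (∑ i ∈ Finset.range (k + 1),
        (∫⁻ x, derivSize i f x ∂weightedMeasure Ω w) / ENNReal.ofReal a) *
        (1 + (Ioo 0 a).indicator
          (fun t => hardyMeasure (isoProfile Ω (weightedMeasure Ω w)) t a univ ^ (k + 1)) t) := by
  set μ := weightedMeasure Ω w
  set A : ℕ → ℝ≥0∞ := fun i => (∫⁻ x, derivSize i f x ∂μ) / ENNReal.ofReal a with hA
  have hstep : ∀ j < k + 1, ∀ u, 0 < u → u < a → maxAvg μ (derivSize j f) u ≤
      A j + ∫⁻ r, maxAvg μ (derivSize (j + 1) f) r ∂hardyMeasure (isoProfile Ω μ) u a := by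
    intro j hj u hu hua
    rw [lintegral_hardyMeasure (hI.aemeasurable.mono_set
      (Ioo_subset_Icc_self.trans (Icc_subset_Icc hu.le haM))) (measurable_maxAvg _)]
    exact maxAvg_derivSize_le hΩ hI haM hI0 hf hj hu hua.le
  rcases lt_or_ge t a with hta | hta
  · refine (rearr_le_maxAvg _ ht).trans ?_
    rw [indicator_of_mem (show t ∈ Ioo 0 a from ⟨ht, hta⟩), iteratedHardy_succ_eq_lintegral
      (hI.aemeasurable.mono_set (Ioo_subset_Icc_self.trans (Icc_subset_Icc ht.le haM)))
      (measurable_maxAvg _) ⟨ht, hta⟩]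
    refine (le_lintegral_add_sum (hardyMeasure (isoProfile Ω μ) t a)
      (D := fun j => maxAvg μ (derivSize j f)) (A := A) (N := k) (fun j => measurable_maxAvg _)
      (hstep 0 k.succ_pos t ht hta) fun j hj => ?_).trans (add_le_add_right ?_ _)
    · filter_upwards [ae_hardyMeasure_mem] with u hu
      rw [hardyMeasure_restrict_Ioi hu.1.le]
      exact hstep (j + 1) (by omega) u (ht.trans hu.1) hu.2
    · rw [Finset.sum_mul]
      refine Finset.sum_le_sum fun i hi => ?_
      gcongr
      exact pow_le_one_add_pow (Finset.mem_range.1 hi).le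
  · rw [indicator_of_notMem (fun h => (not_lt.2 hta) h.2), add_zero, mul_one]
    refine le_trans ?_ le_add_self
    calc rearr μ (derivSize 0 f) t ≤ rearr μ (derivSize 0 f) a := rearr_antitone _ hta
      _ ≤ maxAvg μ (derivSize 0 f) a := rearr_le_maxAvg _ ha
      _ ≤ A 0 := by
          simp only [hA, derivSize_eq_ofReal]
          exact maxAvg_le_lintegral (fun x => norm_nonneg _)
            (aemeasurable_norm_iteratedFDeriv hΩ hf.1 (Nat.zero_le _)) a
      _ ≤ _ := Finset.single_le_sum (f := A) (fun i _ => zero_le)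
          (Finset.mem_range.2 k.succ_pos)

end WeightedMeasure

/-! ### Consequences of the boundedness of `T`. -/

section Boundedness

variable {I : ℝ → ℝ≥0∞} {M a : ℝ} {Xbar Ybar : RISpace (volume.restrict (Ioo (0 : ℝ) M))} {k : ℕ}

theorem measurable_indicator_hardyMeasure_univ_pow (I : ℝ → ℝ≥0∞) (a : ℝ) (k : ℕ) :
    Measurable ((Ioo 0 a).indicator fun t => hardyMeasure I t a univ ^ k) := by
  refine Measurable.indicator (Measurable.pow_const (Antitone.measurable fun s t hst => ?_) k)
    measurableSet_Ioo
  rw [hardyMeasure_univ, hardyMeasure_univ]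
  exact lintegral_mono_set (Ioo_subset_Ioo_left hst)

theorem RISpace.norm_one_lt_top (X : RISpace (volume.restrict (Ioo (0 : ℝ) M))) :
    X.norm (fun _ => 1) < ∞ := by
  simpa using X.norm_indicator_lt_top univ MeasurableSet.univ (by simp)

/-- If `T` is bounded, then `(∫_t^a dz / I(z))^k` has finite norm in the target space. -/
theorem norm_hardyMeasure_univ_pow_lt_top (hI : IsStandardProfile I M) (haM : a ≤ M)
    (hT : IsBoundedBetween (iteratedHardy I a (k + 1)) Xbar Ybar) :
    Ybar.norm ((Ioo 0 a).indicator fun t => hardyMeasure I t a univ ^ (k + 1)) < ∞ := by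
  obtain ⟨C, hC⟩ := hT
  have hT1 := hC (fun _ => 1) aemeasurable_const Xbar.norm_one_lt_top
  have hTm := (measurable_iteratedHardy I a (k + 1) fun _ => 1).aemeasurable
    (μ := volume.restrict (Ioo (0 : ℝ) M))
  -- Test `T` on the constant `1`, which has finite norm because the interval is bounded.
  have hle := Ybar.norm_mono _ (fun t => ((2 ^ k : ℝ≥0) : ℝ≥0∞) *
    iteratedHardy I a (k + 1) (fun _ => 1) t)
    (measurable_indicator_hardyMeasure_univ_pow I a (k + 1)).aemeasurable (hTm.const_mul _)
    (Eventually.of_forall fun t => ?_)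
  · rw [Ybar.norm_smul _ _ hTm] at hle
    refine hle.trans_lt (ENNReal.mul_lt_top ENNReal.coe_lt_top (hT1.trans_lt ?_))
    exact ENNReal.mul_lt_top ENNReal.coe_lt_top Xbar.norm_one_lt_top
  · by_cases ht : t ∈ Ioo 0 a
    · simp only [indicator_of_mem ht]
      rw [iteratedHardy_succ_eq_lintegral (hI.aemeasurable.mono_set
        (Ioo_subset_Icc_self.trans (Icc_subset_Icc ht.1.le haM))) measurable_const ht]
      simpa using measure_univ_pow_le (hardyMeasure I t a) k
    · simp only [indicator_of_notMem ht]
      exact zero_le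

/-- If `T` is bounded, then the profile does not vanish inside `(0, a)`. -/
theorem IsStandardProfile.ne_zero_of_isBoundedBetween (hI : IsStandardProfile I M) (haM : a ≤ M)
    (hT : IsBoundedBetween (iteratedHardy I a (k + 1)) Xbar Ybar) :
    ∀ r ∈ Ioo 0 a, I r ≠ 0 := by
  intro r hr hIr
  obtain ⟨C, hC⟩ := Ybar.lintegral_le univ MeasurableSet.univ (by simp)
  have h := (hC _ (measurable_indicator_hardyMeasure_univ_pow I a (k + 1)).aemeasurable).trans_lt
    (ENNReal.mul_lt_top ENNReal.coe_lt_top (norm_hardyMeasure_univ_pow_lt_top hI haM hT))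
  rw [Measure.restrict_univ] at h
  refine h.not_ge ?_
  -- A zero of `I` would make the power of `ν(t, a)` infinite for every `t` in `(0, a)`, hence not
  -- integrable, although its finite norm forces integrability.
  calc ∞ = ∫⁻ _ in Ioo 0 a, ∞ := by
        rw [setLIntegral_const, ENNReal.top_mul]
        simpa using hr.1.trans hr.2
    _ ≤ ∫⁻ t in Ioo 0 a, (Ioo 0 a).indicator (fun t => hardyMeasure I t a univ ^ (k + 1)) t :=
        setLIntegral_mono' measurableSet_Ioo fun t ht => by
          rw [indicator_of_mem ht, hI.hardyMeasure_univ_eq_top haM hr hIr ht.2,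
            ENNReal.top_pow k.succ_ne_zero]
    _ ≤ _ := lintegral_mono_set (Ioo_subset_Ioo_right haM)

end Boundedness

/-! ### The norm inequality. -/

theorem mainTheorem8 {n : ℕ} (Ω : Set (EuclideanSpace ℝ (Fin n))) (hΩ : IsOpen Ω)
    (hΩc : IsConnected Ω) (w : EuclideanSpace ℝ (Fin n) → ℝ) (hw0 : ∀ x ∈ Ω, 0 ≤ w x)
    (hw : IntegrableOn w Ω)
    (hI : IsStandardProfile (isoProfile Ω (weightedMeasure Ω w))
      ((weightedMeasure Ω w).real univ))
    (k : ℕ) (hk : 1 ≤ k)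
    (X Y : RISpace (weightedMeasure Ω w))
    (Xbar Ybar : RISpace (volume.restrict (Ioo (0 : ℝ) ((weightedMeasure Ω w).real univ))))
    (hX : IsRepresentationSpace X Xbar) (hY : IsRepresentationSpace Y Ybar)
    (hT : IsBoundedBetween
      (iteratedHardy (isoProfile Ω (weightedMeasure Ω w))
        ((weightedMeasure Ω w).real univ / 2) k) Xbar Ybar) :
    ∃ c : ℝ≥0, ∀ f : EuclideanSpace ℝ (Fin n) → ℝ, IsSmoothLip k Ω f →
      Y.norm (fun x => ‖f x‖ₑ) ≤
        c * (Xbar.norm (maxAvg (weightedMeasure Ω w) (derivSize k f)) +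
          ∑ j ∈ Finset.Icc 1 k, ∫⁻ x, derivSize (k - j) f x ∂(weightedMeasure Ω w)) := by
  have hfin := isFiniteMeasure_weightedMeasure hw
  have hf0 : ∀ f : EuclideanSpace ℝ (Fin n) → ℝ, (fun x => ‖f x‖ₑ) = derivSize 0 f := by
    intro f
    rw [derivSize_eq_ofReal]
    ext x
    rw [norm_iteratedFDeriv_zero, ofReal_norm]
  obtain ⟨k, rfl⟩ : ∃ l, k = l + 1 := ⟨k - 1, by omega⟩
  rcases (measureReal_nonneg (μ := weightedMeasure Ω w) (s := univ)).eq_or_lt with hM | hM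
  -- If `M = 0`, then `μ = 0` and every norm on the left vanishes; below, `a = M/2` is positive.
  · refine ⟨0, fun f hf => ?_⟩
    have hμ : weightedMeasure Ω w = 0 := by
      rw [← Measure.measure_univ_eq_zero, ← measureReal_eq_zero_iff]
      exact hM.symm
    have hfm := aemeasurable_derivSize (w := w) hΩ hf.1 (Nat.zero_le _)
    rw [hf0, (Y.norm_eq_zero_iff _ hfm).2]
    · exact zero_le
    · rw [Filter.EventuallyEq, hμ]
      simp
  have ha : 0 < (weightedMeasure Ω w).real univ / 2 := half_pos hM
  have haM : (weightedMeasure Ω w).real univ / 2 ≤ (weightedMeasure Ω w).real univ :=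
    half_le_self hM.le
  have hI0 := hI.ne_zero_of_isBoundedBetween haM hT
  have hW := norm_hardyMeasure_univ_pow_lt_top hI haM hT
  have hWm := (measurable_indicator_hardyMeasure_univ_pow
    (isoProfile Ω (weightedMeasure Ω w)) ((weightedMeasure Ω w).real univ / 2)
    (k + 1)).aemeasurable (μ := volume.restrict (Ioo (0 : ℝ) ((weightedMeasure Ω w).real univ)))
  set W := (Ioo 0 ((weightedMeasure Ω w).real univ / 2)).indicator
    (fun t => hardyMeasure (isoProfile Ω (weightedMeasure Ω w)) t
      ((weightedMeasure Ω w).real univ / 2) univ ^ (k + 1))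
  obtain ⟨C, hC⟩ := hT
  have h1W : AEMeasurable (fun t => 1 + W t)
      (volume.restrict (Ioo (0 : ℝ) ((weightedMeasure Ω w).real univ))) :=
    hWm.const_add 1
  have hB : Ybar.norm (fun t => 1 + W t) < ∞ :=
    (Ybar.norm_add_le (fun _ => 1) W aemeasurable_const hWm).trans_lt
      (ENNReal.add_lt_top.2 ⟨Ybar.norm_one_lt_top, hW⟩)
  obtain ⟨B, hBeq⟩ : ∃ c : ℝ≥0, (c : ℝ≥0∞) = _ := ⟨_, ENNReal.coe_toNNReal hB.ne⟩
  have hainv : (ENNReal.ofReal ((weightedMeasure Ω w).real univ / 2))⁻¹ ≠ ∞ := by simpa using ha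
  obtain ⟨b, hb⟩ : ∃ c : ℝ≥0, (c : ℝ≥0∞) = _ := ⟨_, ENNReal.coe_toNNReal hainv⟩
  -- `C` bounds `T`, `b = 1/a` scales the `L¹` norms and `B` is the norm of `1 + W`. The `1` keeps
  -- the constant nonzero, so that an infinite right side stays infinite.
  refine ⟨C + b * B + 1, fun f hf => ?_⟩
  have hsum : ∑ j ∈ Finset.Icc 1 (k + 1), ∫⁻ x, derivSize (k + 1 - j) f x ∂weightedMeasure Ω w =
      ∑ i ∈ Finset.range (k + 1), ∫⁻ x, derivSize i f x ∂weightedMeasure Ω w := by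
    refine Finset.sum_nbij' (fun j => k + 1 - j) (fun i => k + 1 - i) ?_ ?_ ?_ ?_ fun _ _ => rfl
    all_goals
      intro i hi
      simp only [Finset.mem_Icc, Finset.mem_range] at hi ⊢
      omega
  rw [hsum]
  set D := maxAvg (weightedMeasure Ω w) (derivSize (k + 1) f)
  have hDm : AEMeasurable D (volume.restrict (Ioo (0 : ℝ) ((weightedMeasure Ω w).real univ))) :=
    (measurable_maxAvg _).aemeasurable
  rcases eq_or_ne (Xbar.norm D +
      ∑ i ∈ Finset.range (k + 1), ∫⁻ x, derivSize i f x ∂weightedMeasure Ω w) ∞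
    with htop | htop
  · rw [htop, ENNReal.mul_top (by simp)]
    exact le_top
  obtain ⟨hD, hS⟩ := ENNReal.add_ne_top.1 htop
  obtain ⟨S, hSeq⟩ : ∃ c : ℝ≥0, (c : ℝ≥0∞) = _ := ⟨_, ENNReal.coe_toNNReal hS⟩
  have hAS : ∑ i ∈ Finset.range (k + 1),
      (∫⁻ x, derivSize i f x ∂weightedMeasure Ω w) /
        ENNReal.ofReal ((weightedMeasure Ω w).real univ / 2) =
      ((S * b : ℝ≥0) : ℝ≥0∞) := by
    simp only [div_eq_mul_inv (G := ℝ≥0∞)]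
    rw [← Finset.sum_mul, ← hSeq, ← hb, ENNReal.coe_mul]
  have hfm := aemeasurable_derivSize (w := w) hΩ hf.1 (Nat.zero_le _)
  have hTm : AEMeasurable (iteratedHardy (isoProfile Ω (weightedMeasure Ω w))
      ((weightedMeasure Ω w).real univ / 2) (k + 1) D)
      (volume.restrict (Ioo (0 : ℝ) ((weightedMeasure Ω w).real univ))) :=
    (measurable_iteratedHardy _ _ _ _).aemeasurable
  rw [hf0, hY _ hfm, ← hSeq]
  calc Ybar.norm (rearr (weightedMeasure Ω w) (derivSize 0 f))
      ≤ Ybar.norm (iteratedHardy (isoProfile Ω (weightedMeasure Ω w))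
          ((weightedMeasure Ω w).real univ / 2) (k + 1) D +
          fun t => ((S * b : ℝ≥0) : ℝ≥0∞) * (1 + W t)) := by
        refine Ybar.norm_mono _ _ (rearr_antitone _).measurable.aemeasurable
          (hTm.add (h1W.const_mul _)) ?_
        filter_upwards [ae_restrict_mem measurableSet_Ioo] with t ht
        rw [← hAS]
        exact rearr_derivSize_zero_le hΩ hI haM hI0 ha hf ht.1
    _ ≤ C * Xbar.norm D + ((S * b : ℝ≥0) : ℝ≥0∞) * B := by
        refine (Ybar.norm_add_le _ _ hTm (h1W.const_mul _)).trans ?_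
        rw [Ybar.norm_smul _ _ h1W, hBeq]
        exact add_le_add_left (hC D hDm (lt_top_iff_ne_top.2 hD)) _
    _ ≤ ((C + b * B + 1 : ℝ≥0) : ℝ≥0∞) * Xbar.norm D +
          ((C + b * B + 1 : ℝ≥0) : ℝ≥0∞) * S := by
        refine add_le_add ?_ ?_
        · gcongr
          rw [add_assoc]
          exact le_self_add
        · rw [← ENNReal.coe_mul, ← ENNReal.coe_mul, ENNReal.coe_le_coe, mul_assoc, mul_comm S]
          gcongr
          exact le_add_right le_add_self
    _ = _ := (mul_add _ _ _).symm
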